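/- Let $d\ge 1$ and equip the torus $\mathbb{R}^d/\mathbb{Z}^d$ with the Euclidean metric $\rho(x+\mathbb{Z}^d,y+\mathbb{Z}^d)=\min_{m\in\mathbb{Z}^d}|x-y-m|$, where $|\cdot|$ is the Euclidean norm. For Borel probability measures $\nu_1,\nu_2$ on $\mathbb{R}^d/\mathbb{Z}^d$ let \[ W_1(\nu_1,\nu_2)=\inf_{\vartheta}\int \rho(x,y)\,\mathrm{d}\vartheta(x,y), \] where $\vartheta$ runs over all couplings of $\nu_1$ and $\nu_2$, i.e. Borel probability measures on $(\mathbb{R}^d/\mathbb{Z}^d)^2$ with marginals $\nu_1$ and $\nu_2$, and let $\widehat{\nu}(h)=\int e^{-2\pi i\langle h,x\rangle}\,\mathrm{d}\nu(x)$ for $h\in\mathbb{Z}^d$. Then for all Borel probability measures $\nu_1,\nu_2$ on $\mathbb{R}^d/\mathbb{Z}^d$ and every integer $H\ge 1$, \[ W_1(\nu_1,\nu_2)\le\frac{6d}{H}+\frac{\sqrt d}{2\pi}\left(\sum_{h\in\mathbb{Z}^d,\ 0<\|h\|_\infty<H}\frac{|\widehat{\nu_1}(h)-\widehat{\nu_2}(h)|^2}{|h|^2}\right)^{1/2},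 \] where $\|h\|_\infty=\max_{1\le j\le d}|h_j|$. -/

import Mathlib

open MeasureTheory

namespace TorusWasserstein

/-- The Euclidean distance on the torus `ℝ^d / ℤ^d`: the `ℓ²`-product of the distances on the
circles `ℝ / ℤ`. The next theorem identifies it with `min_{m ∈ ℤ^d} |x - y - m|`. -/
noncomputable def torusDist {d : ℕ} (x y : UnitAddTorus (Fin d)) : ℝ :=
  dist (WithLp.toLp 2 x) (WithLp.toLp 2 y)

theorem torusDist_isLeast {d : ℕ} (x y : EuclideanSpace ℝ (Fin d)) :
    IsLeast (Set.range fun m : Fin d → ℤ => ‖x - y - WithLp.toLp 2 (fun i => (m i : ℝ))‖)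
      (torusDist (fun i => (x i : UnitAddCircle)) (fun i => (y i : UnitAddCircle))) := by
  have key : torusDist (fun i => (x i : UnitAddCircle)) (fun i => (y i : UnitAddCircle)) =
      √(∑ i, |x i - y i - round (x i - y i)| ^ 2) := by
    rw [torusDist, PiLp.dist_eq_of_L2]
    congr 1
    refine Finset.sum_congr rfl fun i _ => ?_
    rw [dist_eq_norm]
    change ‖((x i : ℝ) : UnitAddCircle) - ((y i : ℝ) : UnitAddCircle)‖ ^ 2 = _
    rw [← AddCircle.coe_sub, UnitAddCircle.norm_eq]
  rw [key]
  constructor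
  · refine ⟨fun i => round (x i - y i), ?_⟩
    simp [EuclideanSpace.norm_eq]
  · rintro _ ⟨m, rfl⟩
    simp only [EuclideanSpace.norm_eq]
    refine Real.sqrt_le_sqrt (Finset.sum_le_sum fun i _ => ?_)
    have h := round_le (x i - y i) (m i)
    simpa using pow_le_pow_left₀ (abs_nonneg _) h 2

/-- `ϑ` is a coupling of `ν₁` and `ν₂`: a Borel probability measure with these marginals. -/
structure IsCoupling {d : ℕ} (ϑ : Measure (UnitAddTorus (Fin d) × UnitAddTorus (Fin d)))
    (ν₁ ν₂ : Measure (UnitAddTorus (Fin d))) : Prop where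
  isProbabilityMeasure : IsProbabilityMeasure ϑ
  map_fst : ϑ.map Prod.fst = ν₁
  map_snd : ϑ.map Prod.snd = ν₂

/-- The `1`-Wasserstein distance for the Euclidean metric on `ℝ^d / ℤ^d`: the infimum of the
transport cost over all couplings. -/
noncomputable def wassersteinOne {d : ℕ} (ν₁ ν₂ : Measure (UnitAddTorus (Fin d))) : ℝ :=
  sInf {c : ℝ | ∃ ϑ : Measure (UnitAddTorus (Fin d) × UnitAddTorus (Fin d)),
    IsCoupling ϑ ν₁ ν₂ ∧ c = ∫ z, torusDist z.1 z.2 ∂ϑ}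

/-- The Fourier coefficient `∫ e^{-2πi⟨h, x⟩} dν(x)` of a measure on the torus. -/
noncomputable def fourierCoeffMeasure {d : ℕ} (ν : Measure (UnitAddTorus (Fin d)))
    (h : Fin d → ℤ) : ℂ :=
  ∫ x, UnitAddTorus.mFourier (-h) x ∂ν

/-- The lattice points `h ∈ ℤ^d` with `0 < ‖h‖_∞ < H`. -/
noncomputable def freqBox (d H : ℕ) : Finset (Fin d → ℤ) :=
  (Fintype.piFinset fun _ : Fin d => Finset.Ioo (-(H : ℤ)) (H : ℤ)).erase 0

/-- The norm on `Fin d → ℤ` is the maximum norm. -/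
theorem mem_freqBox {d H : ℕ} {h : Fin d → ℤ} :
    h ∈ freqBox d H ↔ 0 < ‖h‖ ∧ ‖h‖ < (H : ℝ) := by
  rw [freqBox, Finset.mem_erase, norm_pos_iff]
  refine and_congr_right fun hne => ?_
  have hpos : 0 < H ↔ (0 : ℝ) < H := Nat.cast_pos.symm
  by_cases hH : 0 < H
  · rw [pi_norm_lt_iff (hpos.1 hH), Fintype.mem_piFinset]
    refine forall_congr' fun i => ?_
    rw [Finset.mem_Ioo, ← abs_lt, Int.norm_eq_abs, ← Int.cast_abs]
    exact_mod_cast Iff.rfl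
  · have h0 : H = 0 := by omega
    subst h0
    constructor
    · intro hm
      exfalso
      apply hne
      funext i
      have := Finset.mem_Ioo.1 (Fintype.mem_piFinset.1 hm i)
      simp at this
      omega
    · intro hm
      have := norm_nonneg h
      simp at hm
      linarith

end TorusWasserstein

/-!
The bound is a smoothing inequality. By Kantorovich duality (`exists_coupling_integral_le`) it
suffices to bound `∫ u dν₁ - ∫ u dν₂` for Lipschitz functions `u`, and any such bound produces a
coupling of at most that cost. The duality is obtained from the Hahn–Banach theorem on `C(X × X)`,
applied to the smallest price of a function `f ⊕ g + t c` dominating a given one, and from the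
Riesz–Markov–Kakutani theorem, which turns the resulting positive functional into a measure.

A function `u` with Lipschitz constant `t` is replaced by its convolution with a product of
Fejér–Korovkin kernels, which are non-negative trigonometric polynomials with frequencies in
`|h i| < H`. The first Fourier coefficient `cos (π / (H + 1))` of the one-dimensional kernel
controls its second moment, so the convolution differs from `u` by at most `t d / H`
(`abs_sub_smoothed_le`).

The convolution is a trigonometric polynomial whose coefficients are at most those of `u`, and the
coefficients of `u` satisfy `∑ |h|² |û h|² ≤ d t² / (2π)²`
(`sum_normSq_mul_norm_sq_realCoeff_le`), by Bessel's inequality for difference quotients of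
`u`. The Cauchy–Schwarz inequality then bounds the difference of the integrals of the convolution
(`abs_integral_smoothed_sub_le`). The frequency `0` does not contribute because `ν₁` and `ν₂` have
the same mass.
-/

namespace TorusWasserstein

/-! ### Kantorovich duality on a compact space -/

section Duality

variable {X : Type*} [MetricSpace X] [CompactSpace X] [MeasurableSpace X] [BorelSpace X]

lemma integrable_of_continuous {E : Type*} [NormedAddCommGroup E] {f : X → E} (hf : Continuous f)
    (ν : Measure X) [IsFiniteMeasure ν] : Integrable f ν :=
  hf.integrable_of_hasCompactSupport (HasCompactSupport.of_compactSpace f)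

/-- Consistency of the dual problem: whenever `f ⊕ g + t c ≥ -m`, the price
`∫ f dν₁ + ∫ g dν₂ + t D` is at least `-m`. The infimal convolution `u x = inf_y (g y + t c x y)`
is a `t`-Lipschitz function with `-m - f ≤ u ≤ g`, to which the hypothesis `hD` applies. -/
lemma neg_le_integral_add_integral (ν₁ ν₂ : Measure X) [IsProbabilityMeasure ν₁]
    [IsProbabilityMeasure ν₂] {c : X → X → ℝ} (hc : Continuous fun z : X × X => c z.1 z.2)
    (hself : ∀ x, c x x = 0) (hsymm : ∀ x y, c x y = c y x)
    (htri : ∀ x y z, c x z ≤ c x y + c y z) {D : ℝ}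
    (hD : ∀ (t : ℝ) (u : C(X, ℝ)), 0 ≤ t → (∀ x y, u x - u y ≤ t * c x y) →
      ∫ x, u x ∂ν₁ - ∫ x, u x ∂ν₂ ≤ t * D)
    {f g : C(X, ℝ)} {t m : ℝ} (ht : 0 ≤ t) (hfg : ∀ x y, -m ≤ f x + g y + t * c x y) :
    -m ≤ ∫ x, f x ∂ν₁ + ∫ x, g x ∂ν₂ + t * D := by
  have hbdd : ∀ x, BddBelow (Set.range fun y => g y + t * c x y) := fun x =>
    ⟨-m - f x, by rintro _ ⟨y, rfl⟩; linarith [hfg x y]⟩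
  set u : X → ℝ := fun x => ⨅ y, g y + t * c x y
  have hlip : ∀ x y, u x - u y ≤ t * c x y := by
    intro x y
    have : Nonempty X := ⟨x⟩
    have : u x - t * c x y ≤ u y := le_ciInf fun z => by
      have h1 : u x ≤ g z + t * c x z := ciInf_le (hbdd x) z
      have h2 := mul_le_mul_of_nonneg_left (htri x y z) ht
      linarith
    linarith
  have hcont : Continuous u := by
    rw [continuous_iff_continuousAt]
    intro x
    have hlim : Filter.Tendsto (fun y => t * c y x) (nhds x) (nhds 0) := by
      have : Continuous fun y => t * c y x :=
        continuous_const.mul (hc.comp (continuous_id.prodMk continuous_const))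
      simpa [hself] using this.tendsto x
    refine tendsto_iff_dist_tendsto_zero.2
      (squeeze_zero (fun _ => dist_nonneg) (fun y => ?_) hlim)
    rw [Real.dist_eq, abs_le]
    constructor
    · have := hlip x y
      rw [hsymm x y] at this
      linarith
    · exact hlip y x
  have hD' := hD t ⟨u, hcont⟩ ht hlip
  have h1 : ∫ x, u x ∂ν₂ ≤ ∫ x, g x ∂ν₂ :=
    integral_mono (integrable_of_continuous hcont ν₂) (integrable_of_continuous g.continuous ν₂)
      fun x => by
        have := ciInf_le (hbdd x) x
        simpa [hself] using this
  have h2 : -m ≤ ∫ x, (f x + u x) ∂ν₁ := by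
    have : ∫ _, -m ∂ν₁ ≤ ∫ x, (f x + u x) ∂ν₁ := by
      refine integral_mono (integrable_const _)
        ((integrable_of_continuous f.continuous ν₁).add (integrable_of_continuous hcont ν₁))
        fun x => ?_
      have : Nonempty X := ⟨x⟩
      have : -m - f x ≤ u x := le_ciInf fun y => by linarith [hfg x y]
      change -m ≤ f x + u x
      linarith
    simpa using this
  have h3 : ∫ x, (f x + u x) ∂ν₁ = ∫ x, f x ∂ν₁ + ∫ x, u x ∂ν₁ :=
    integral_add (integrable_of_continuous f.continuous ν₁) (integrable_of_continuous hcont ν₁)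
  change ∫ x, u x ∂ν₁ - ∫ x, u x ∂ν₂ ≤ t * D at hD'
  linarith

/-- The prices `∫ f dν₁ + ∫ g dν₂ + t D`, `t ≥ 0`, of the functions `f ⊕ g + t c` that dominate
`φ`. Their infimum is a sublinear functional of `φ`. -/
def dominatingPrices (ν₁ ν₂ : Measure X) (c : X → X → ℝ) (D : ℝ) (φ : C(X × X, ℝ)) : Set ℝ :=
  {r | ∃ (f g : C(X, ℝ)) (t : ℝ), 0 ≤ t ∧ (∀ x y, φ (x, y) ≤ f x + g y + t * c x y) ∧
    r = ∫ x, f x ∂ν₁ + ∫ x, g x ∂ν₂ + t * D}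

/-- A linear functional bounded by the price of every dominating function `f ⊕ g + t c`, by the
Hahn–Banach theorem. Comparing with `0`, with `± (f ⊕ g)` and with `c` shows that it is positive,
that it has marginals `ν₁` and `ν₂`, and that its value at `c` is at most `D`. -/
theorem exists_coupling_functional (ν₁ ν₂ : Measure X) [IsProbabilityMeasure ν₁]
    [IsProbabilityMeasure ν₂] {c : X → X → ℝ} (hc : Continuous fun z : X × X => c z.1 z.2)
    (hself : ∀ x, c x x = 0) (hsymm : ∀ x y, c x y = c y x)
    (htri : ∀ x y z, c x z ≤ c x y + c y z) {D : ℝ}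
    (hD : ∀ (t : ℝ) (u : C(X, ℝ)), 0 ≤ t → (∀ x y, u x - u y ≤ t * c x y) →
      ∫ x, u x ∂ν₁ - ∫ x, u x ∂ν₂ ≤ t * D) :
    ∃ Λ : C(X × X, ℝ) →ₗ[ℝ] ℝ, (∀ (φ : C(X × X, ℝ)) (f g : C(X, ℝ)) (t : ℝ), 0 ≤ t →
      (∀ x y, φ (x, y) ≤ f x + g y + t * c x y) →
      Λ φ ≤ ∫ x, f x ∂ν₁ + ∫ x, g x ∂ν₂ + t * D) := by
  set S := dominatingPrices ν₁ ν₂ c D with hS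
  have hne : ∀ φ, (S φ).Nonempty := fun φ =>
    ⟨_, ContinuousMap.const X ‖φ‖, 0, 0, le_rfl, fun x y => by
      simpa using (le_abs_self _).trans (φ.norm_coe_le_norm (x, y)), rfl⟩
  have hlow : ∀ φ, ∀ r ∈ S φ, -‖φ‖ ≤ r := by
    rintro φ _ ⟨f, g, t, ht, hφ, rfl⟩
    refine neg_le_integral_add_integral ν₁ ν₂ hc hself hsymm htri hD ht fun x y => ?_
    exact ((abs_le.1 (φ.norm_coe_le_norm (x, y))).1).trans (hφ x y)
  have hbdd : ∀ φ, BddBelow (S φ) := fun φ => ⟨_, hlow φ⟩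
  have hsmul : ∀ a : ℝ, 0 < a → ∀ φ, sInf (S (a • φ)) ≤ a * sInf (S φ) := by
    intro a ha φ
    rw [← div_le_iff₀' ha]
    refine le_csInf (hne φ) ?_
    rintro _ ⟨f, g, t, ht, hφ, rfl⟩
    rw [div_le_iff₀' ha]
    refine csInf_le (hbdd _) ⟨a • f, a • g, a * t, by positivity, fun x y => ?_, ?_⟩
    · have := mul_le_mul_of_nonneg_left (hφ x y) ha.le
      simp only [ContinuousMap.smul_apply, smul_eq_mul]
      linarith
    · simp only [ContinuousMap.smul_apply, smul_eq_mul, integral_const_mul]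
      ring
  obtain ⟨Λ, -, hΛ⟩ := exists_extension_of_le_sublinear (⊥ : C(X × X, ℝ) →ₗ.[ℝ] ℝ)
    (fun φ => sInf (S φ))
    (fun a ha φ => by
      refine le_antisymm (hsmul a ha φ) ?_
      have := hsmul a⁻¹ (inv_pos.2 ha) (a • φ)
      rw [inv_smul_smul₀ ha.ne'] at this
      rwa [← le_inv_mul_iff₀ ha])
    (fun φ ψ => by
      rw [← csInf_add (hne φ) (hbdd φ) (hne ψ) (hbdd ψ)]
      refine csInf_le_csInf (hbdd _) ((hne φ).add (hne ψ)) ?_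
      rintro _ ⟨_, ⟨f, g, t, ht, hφ, rfl⟩, _, ⟨f', g', t', ht', hψ, rfl⟩, rfl⟩
      refine ⟨f + f', g + g', t + t', add_nonneg ht ht', fun x y => ?_, ?_⟩
      · have := hφ x y
        have := hψ x y
        simp only [ContinuousMap.add_apply]
        linarith
      · simp only [ContinuousMap.add_apply]
        rw [integral_add (integrable_of_continuous f.continuous _)
            (integrable_of_continuous f'.continuous _),
          integral_add (integrable_of_continuous g.continuous _)
            (integrable_of_continuous g'.continuous _)]
        ring)
    (fun φ => by
      obtain ⟨φ, hφ⟩ := φ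
      have h0 : φ = 0 := (Submodule.mem_bot ℝ).1 hφ
      subst h0
      have : (⊥ : C(X × X, ℝ) →ₗ.[ℝ] ℝ) ⟨0, hφ⟩ = 0 := LinearPMap.map_zero _
      rw [this]
      exact le_csInf (hne 0) fun r hr => by simpa using hlow 0 r hr)
  exact ⟨Λ, fun φ f g t ht hφ => (hΛ φ).trans (csInf_le (hbdd φ) ⟨f, g, t, ht, hφ, rfl⟩)⟩

/-- The hard direction of Kantorovich–Rubinstein duality: if `∫ u dν₁ - ∫ u dν₂ ≤ t D` for every
function `u` that is `t`-Lipschitz for the cost `c`, then some coupling has cost at most `D`. -/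
theorem exists_coupling_integral_le (ν₁ ν₂ : Measure X) [IsProbabilityMeasure ν₁]
    [IsProbabilityMeasure ν₂] {c : X → X → ℝ} (hc : Continuous fun z : X × X => c z.1 z.2)
    (hself : ∀ x, c x x = 0) (hsymm : ∀ x y, c x y = c y x)
    (htri : ∀ x y z, c x z ≤ c x y + c y z) {D : ℝ}
    (hD : ∀ (t : ℝ) (u : C(X, ℝ)), 0 ≤ t → (∀ x y, u x - u y ≤ t * c x y) →
      ∫ x, u x ∂ν₁ - ∫ x, u x ∂ν₂ ≤ t * D) :
    ∃ ϑ : Measure (X × X), IsProbabilityMeasure ϑ ∧ ϑ.map Prod.fst = ν₁ ∧ ϑ.map Prod.snd = ν₂ ∧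
      ∫ z, c z.1 z.2 ∂ϑ ≤ D := by
  obtain ⟨Λ, hΛ⟩ := exists_coupling_functional ν₁ ν₂ hc hself hsymm htri hD
  let Λ' : CompactlySupportedContinuousMap (X × X) ℝ →ₚ[ℝ] ℝ := PositiveLinearMap.mk₀
    { toFun := fun φ => Λ φ.toContinuousMap
      map_add' := fun φ ψ => Λ.map_add φ.toContinuousMap ψ.toContinuousMap
      map_smul' := fun a φ => Λ.map_smul a φ.toContinuousMap }
    (fun φ hφ => by
      have h := hΛ (-φ.toContinuousMap) 0 0 0 le_rfl fun x y => by
        have : 0 ≤ φ (x, y) := hφ (x, y)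
        simpa using this
      simp only [map_neg, ContinuousMap.zero_apply, integral_zero, zero_mul, add_zero] at h
      change 0 ≤ Λ φ.toContinuousMap
      linarith)
  set ϑ := RealRMK.rieszMeasure Λ' with hϑ
  have hint : ∀ φ : C(X × X, ℝ), ∫ z, φ z ∂ϑ = Λ φ := fun φ =>
    RealRMK.integral_rieszMeasure Λ' (CompactlySupportedContinuousMap.continuousMapEquiv φ)
  have hle : ∀ (φ : C(X × X, ℝ)) (f g : C(X, ℝ)), (∀ x y, φ (x, y) = f x + g y) →
      Λ φ = ∫ x, f x ∂ν₁ + ∫ x, g x ∂ν₂ := by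
    intro φ f g h
    have h1 := hΛ φ f g 0 le_rfl fun x y => by simp [h]
    have h2 := hΛ (-φ) (-f) (-g) 0 le_rfl fun x y => by simp [h]
    simp only [map_neg, ContinuousMap.neg_apply, integral_neg] at h2
    linarith
  have : IsFiniteMeasure ϑ := inferInstance
  have hfst : ϑ.map Prod.fst = ν₁ := by
    refine ext_of_forall_integral_eq_of_IsFiniteMeasure fun f => ?_
    rw [integral_map measurable_fst.aemeasurable f.continuous.aestronglyMeasurable]
    have h := hint (f.toContinuousMap.comp ContinuousMap.fst)
    rw [hle _ f.toContinuousMap 0 fun x y => by simp] at h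
    simpa using h
  have hsnd : ϑ.map Prod.snd = ν₂ := by
    refine ext_of_forall_integral_eq_of_IsFiniteMeasure fun f => ?_
    rw [integral_map measurable_snd.aemeasurable f.continuous.aestronglyMeasurable]
    have h := hint (f.toContinuousMap.comp ContinuousMap.snd)
    rw [hle _ 0 f.toContinuousMap fun x y => by simp] at h
    simpa using h
  refine ⟨ϑ, ⟨?_⟩, hfst, hsnd, ?_⟩
  · have : ϑ.map Prod.fst Set.univ = 1 := by rw [hfst]; exact measure_univ
    rwa [Measure.map_apply measurable_fst MeasurableSet.univ, Set.preimage_univ] at this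
  · have h := hΛ ⟨_, hc⟩ 0 0 1 zero_le_one fun x y => by simp
    rw [← hint] at h
    simpa using h

end Duality

/-! ### The Fejér–Korovkin kernel on the circle -/

section Circle

/-- The weights `sin (π k / (H + 1))`, which vanish at `k = 0` and `k = H + 1`. They form the top
eigenvector of the path on `{1, …, H}`, see `sineWeight_add_two`. -/
noncomputable def sineWeight (H k : ℕ) : ℝ := Real.sin (Real.pi * k / (H + 1))

lemma sineWeight_zero (H : ℕ) : sineWeight H 0 = 0 := by simp [sineWeight]

lemma sineWeight_last (H : ℕ) : sineWeight H (H + 1) = 0 := by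
  have : (H : ℝ) + 1 ≠ 0 := by positivity
  simp [sineWeight, this]

lemma sineWeight_add_two (H k : ℕ) :
    sineWeight H (k + 2) + sineWeight H k =
      2 * Real.cos (Real.pi / (H + 1)) * sineWeight H (k + 1) := by
  have h1 : Real.pi * ((k + 2 : ℕ) : ℝ) / (H + 1) =
      Real.pi * ((k + 1 : ℕ) : ℝ) / (H + 1) + Real.pi / (H + 1) := by push_cast; ring
  have h2 : Real.pi * (k : ℝ) / (H + 1) =
      Real.pi * ((k + 1 : ℕ) : ℝ) / (H + 1) - Real.pi / (H + 1) := by push_cast; ring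
  simp only [sineWeight]
  rw [h1, h2, Real.sin_add, Real.sin_sub]
  ring

/-- The sum of the squares of the weights `sineWeight H k`, `1 ≤ k ≤ H`. -/
noncomputable def sineMass (H : ℕ) : ℝ := ∑ k ∈ Finset.range H, sineWeight H (k + 1) ^ 2

lemma sineMass_pos {H : ℕ} (hH : 1 ≤ H) : 0 < sineMass H := by
  have h1 : 0 < sineWeight H (0 + 1) := by
    have hH' : (1 : ℝ) ≤ H := by exact_mod_cast hH
    refine Real.sin_pos_of_pos_of_lt_pi (by positivity) ?_
    rw [div_lt_iff₀ (by positivity)]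
    have := Real.pi_pos
    push_cast
    nlinarith
  exact (pow_pos h1 2).trans_le (Finset.single_le_sum (f := fun k => sineWeight H (k + 1) ^ 2)
    (fun k _ => sq_nonneg _) (Finset.mem_range.2 hH))

lemma sum_sineWeight_mul_succ (H : ℕ) :
    ∑ k ∈ Finset.range H, sineWeight H (k + 1) * sineWeight H (k + 2) =
      Real.cos (Real.pi / (H + 1)) * sineMass H := by
  have hshift : ∑ k ∈ Finset.range H, sineWeight H (k + 1) * sineWeight H (k + 2) =
      ∑ k ∈ Finset.range H, sineWeight H k * sineWeight H (k + 1) := by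
    have h1 := Finset.sum_range_succ (fun k => sineWeight H k * sineWeight H (k + 1)) H
    rw [Finset.sum_range_succ', sineWeight_last, sineWeight_zero] at h1
    simpa using h1
  have hsum : ∑ k ∈ Finset.range H, sineWeight H (k + 1) * sineWeight H (k + 2) +
      ∑ k ∈ Finset.range H, sineWeight H k * sineWeight H (k + 1) =
      2 * (Real.cos (Real.pi / (H + 1)) * sineMass H) := by
    rw [sineMass, Finset.mul_sum, Finset.mul_sum, ← Finset.sum_add_distrib]
    refine Finset.sum_congr rfl fun k _ => ?_
    linear_combination sineWeight H (k + 1) * sineWeight_add_two H k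
  linarith

/-- The Fejér–Korovkin kernel on the circle: a non-negative trigonometric polynomial of degree less
than `H` and mean `1`. -/
noncomputable def circleKernel (H : ℕ) (x : UnitAddCircle) : ℝ :=
  ‖∑ k ∈ Finset.range H, (sineWeight H (k + 1) : ℂ) * fourier (k : ℤ) x‖ ^ 2 / sineMass H

/-- The Fourier coefficient of `circleKernel H` at the frequency `h`. -/
noncomputable def circleKernelCoeff (H : ℕ) (h : ℤ) : ℝ :=
  (∑ k ∈ Finset.range H, ∑ l ∈ Finset.range H,
    if (k : ℤ) - l = h then sineWeight H (k + 1) * sineWeight H (l + 1) else 0) / sineMass H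

lemma circleKernel_nonneg (H : ℕ) (x : UnitAddCircle) : 0 ≤ circleKernel H x :=
  div_nonneg (sq_nonneg _) (Finset.sum_nonneg fun _ _ => sq_nonneg _)

lemma continuous_circleKernel (H : ℕ) : Continuous (circleKernel H) := by
  unfold circleKernel
  fun_prop

lemma circleKernel_eq_sum (H : ℕ) (x : UnitAddCircle) :
    (circleKernel H x : ℂ) =
      ∑ h ∈ Finset.Ioo (-(H : ℤ)) H, (circleKernelCoeff H h : ℂ) * fourier h x := by
  have hsq : ((‖∑ k ∈ Finset.range H, (sineWeight H (k + 1) : ℂ) * fourier (k : ℤ) x‖ ^ 2 : ℝ) : ℂ)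
      = ∑ k ∈ Finset.range H, ∑ l ∈ Finset.range H,
        ((sineWeight H (k + 1) * sineWeight H (l + 1) : ℝ) : ℂ) * fourier ((k : ℤ) - l) x := by
    push_cast
    rw [← Complex.mul_conj', map_sum, Finset.sum_mul_sum]
    refine Finset.sum_congr rfl fun k _ => Finset.sum_congr rfl fun l _ => ?_
    rw [map_mul, Complex.conj_ofReal, ← fourier_neg, sub_eq_add_neg, fourier_add]
    ring
  simp only [circleKernel, circleKernelCoeff, Complex.ofReal_div, hsq]
  push_cast
  simp only [div_mul_eq_mul_div, ← Finset.sum_div, Finset.sum_mul]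
  congr 1
  symm
  rw [Finset.sum_comm]
  refine Finset.sum_congr rfl fun k hk => ?_
  rw [Finset.sum_comm]
  refine Finset.sum_congr rfl fun l hl => ?_
  rw [Finset.sum_eq_single ((k : ℤ) - l)]
  · simp
  · intro h _ hne
    simp [hne.symm]
  · intro hn
    rw [Finset.mem_range] at hk hl
    exact absurd (Finset.mem_Ioo.2 (by omega)) hn

lemma circleKernelCoeff_eq_zero {H : ℕ} {h : ℤ} (hh : h ∉ Finset.Ioo (-(H : ℤ)) H) :
    circleKernelCoeff H h = 0 := by
  rw [circleKernelCoeff, Finset.sum_eq_zero, zero_div]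
  refine fun k hk => Finset.sum_eq_zero fun l hl => if_neg fun h' => hh ?_
  rw [Finset.mem_range] at hk hl
  rw [Finset.mem_Ioo]
  omega

lemma circleKernelCoeff_zero {H : ℕ} (hH : 1 ≤ H) : circleKernelCoeff H 0 = 1 := by
  rw [circleKernelCoeff, div_eq_one_iff_eq (sineMass_pos hH).ne', sineMass]
  refine Finset.sum_congr rfl fun k hk => ?_
  rw [Finset.sum_eq_single_of_mem k hk]
  · simp [sq]
  · intro l _ hl
    exact if_neg (by omega)

/-- The first Fourier coefficient differs from `1` only by `O(H⁻²)`: this is what makes the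
kernel concentrate at scale `1 / H`. -/
lemma circleKernelCoeff_one {H : ℕ} (hH : 1 ≤ H) :
    circleKernelCoeff H 1 = Real.cos (Real.pi / (H + 1)) := by
  rw [circleKernelCoeff, div_eq_iff (sineMass_pos hH).ne', ← sum_sineWeight_mul_succ,
    Finset.sum_comm]
  refine Finset.sum_congr rfl fun l hl => ?_
  rw [Finset.mem_range] at hl
  by_cases hl' : l + 1 < H
  · rw [Finset.sum_eq_single_of_mem (l + 1) (Finset.mem_range.2 hl')]
    · rw [if_pos (by push_cast; ring)]
      ring
    · intro k _ hk
      exact if_neg (by omega)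
  · have : l + 2 = H + 1 := by omega
    rw [this, sineWeight_last, mul_zero]
    refine Finset.sum_eq_zero fun k hk => if_neg ?_
    rw [Finset.mem_range] at hk
    omega

lemma one_sub_circleKernelCoeff_one_le {H : ℕ} (hH : 1 ≤ H) :
    1 - circleKernelCoeff H 1 ≤ 8 / (H : ℝ) ^ 2 := by
  have hH' : (1 : ℝ) ≤ H := by exact_mod_cast hH
  rw [circleKernelCoeff_one hH]
  have h1 := Real.one_sub_sq_div_two_le_cos (x := Real.pi / (H + 1))
  have h2 : (Real.pi / (H + 1)) ^ 2 ≤ 16 / (H : ℝ) ^ 2 := by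
    rw [div_pow]
    have := Real.pi_le_four
    have := Real.pi_pos
    gcongr
    · nlinarith
    · linarith
  have h3 : 16 / (H : ℝ) ^ 2 = 2 * (8 / (H : ℝ) ^ 2) := by ring
  linarith

/-- The squared distance to `0` on the circle is controlled by a trigonometric polynomial of
degree `1`, so the second moment of a kernel is controlled by its first Fourier coefficient. -/
lemma norm_sq_le_one_sub_re_fourier (y : UnitAddCircle) :
    ‖y‖ ^ 2 ≤ (1 - (fourier (-1) y).re) / 8 := by
  obtain ⟨x, rfl⟩ := QuotientAddGroup.mk_surjective y
  change ‖(x : UnitAddCircle)‖ ^ 2 ≤ (1 - (fourier (-1) (x : UnitAddCircle)).re) / 8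
  rw [UnitAddCircle.norm_eq]
  set r := x - round x with hr
  have hx : (fourier (-1) (x : UnitAddCircle)).re = Real.cos (2 * (Real.pi * r)) := by
    have h1 : (x : UnitAddCircle) = (r : UnitAddCircle) := by
      rw [hr, AddCircle.coe_sub]
      have : ((round x : ℝ) : UnitAddCircle) = 0 := by
        have := AddCircle.coe_period (p := (1 : ℝ))
        rw [show ((round x : ℤ) : ℝ) = (round x) • (1 : ℝ) by simp, AddCircle.coe_zsmul, this,
          smul_zero]
      rw [this, sub_zero]
    rw [h1, fourier_coe_apply]
    have : (2 * Real.pi * Complex.I * ((-1 : ℤ) : ℂ) * r / ((1 : ℝ) : ℂ)) =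
        ((-(2 * (Real.pi * r)) : ℝ) : ℂ) * Complex.I := by push_cast; ring
    rw [this, Complex.exp_ofReal_mul_I_re, Real.cos_neg]
  have hr2 : |r| ≤ 1 / 2 := abs_sub_round x
  have hs := Real.mul_abs_le_abs_sin (x := Real.pi * r) (by
    rw [abs_mul, abs_of_pos Real.pi_pos]
    nlinarith [Real.pi_pos])
  rw [abs_mul, abs_of_pos Real.pi_pos, ← mul_assoc, div_mul_cancel₀ _ Real.pi_ne_zero] at hs
  have hs2 := pow_le_pow_left₀ (by positivity) hs 2
  rw [sq_abs, mul_pow] at hs2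
  rw [hx, Real.cos_two_mul]
  nlinarith [Real.sin_sq_add_cos_sq (Real.pi * r)]

end Circle

/-! ### Haar measure and Bessel's inequality on the torus -/

section Torus

variable {d : ℕ}

/-- The Haar probability measure on the torus. It is written out as a product because the default
`volume` on the circle is a different term from the one used by the Fourier library. -/
noncomputable abbrev torusHaar (d : ℕ) : Measure (UnitAddTorus (Fin d)) :=
  Measure.pi fun _ => AddCircle.haarAddCircle

lemma integral_mFourier (h : Fin d → ℤ) :
    ∫ x, UnitAddTorus.mFourier h x ∂torusHaar d = if h = 0 then 1 else 0 := by
  have := (orthonormal_iff_ite.1 (UnitAddTorus.orthonormal_mFourier (d := Fin d))) 0 h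
  rw [ContinuousMap.inner_toLp] at this
  simp only [UnitAddTorus.mFourier_zero, ContinuousMap.one_apply, map_one, mul_one,
    eq_comm (a := (0 : Fin d → ℤ))] at this
  exact this

/-- Bessel's inequality for a continuous function on the torus. -/
lemma sum_norm_sq_integral_mFourier_le (v : C(UnitAddTorus (Fin d), ℂ))
    (s : Finset (Fin d → ℤ)) :
    ∑ h ∈ s, ‖∫ x, UnitAddTorus.mFourier (-h) x * v x ∂torusHaar d‖ ^ 2 ≤
      ∫ x, ‖v x‖ ^ 2 ∂torusHaar d := by
  have hle := sum_le_hasSum s (fun _ _ => sq_nonneg _)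
    (UnitAddTorus.hasSum_sq_mFourierCoeff (ContinuousMap.toLp 2 (torusHaar d) ℂ v))
  have hcoeff : ∀ h, ∫ x, UnitAddTorus.mFourier (-h) x * v x ∂torusHaar d =
      UnitAddTorus.mFourierCoeff (ContinuousMap.toLp 2 (torusHaar d) ℂ v) h :=
    fun h => (UnitAddTorus.mFourierCoeff_toLp v h).symm
  simp only [hcoeff]
  refine hle.trans (le_of_eq (integral_congr_ae ?_))
  filter_upwards [ContinuousMap.coeFn_toLp (p := 2) (𝕜 := ℂ) (torusHaar d) v] with x hx
  exact congrArg (fun z => ‖z‖ ^ 2) hx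

instance : (torusHaar d).IsNegInvariant := Measure.pi.isNegInvariant _

end Torus

/-! ### The product kernel and smoothing of Lipschitz functions -/

section Smoothing

variable {d : ℕ}

/-- The product of the kernels `circleKernel H` over the coordinates. -/
noncomputable def torusKernel (d H : ℕ) (y : UnitAddTorus (Fin d)) : ℝ :=
  ∏ i, circleKernel H (y i)

/-- The Fourier coefficient of `torusKernel d H` at the frequency `h`. -/
noncomputable def torusKernelCoeff {d : ℕ} (H : ℕ) (h : Fin d → ℤ) : ℝ :=
  ∏ i, circleKernelCoeff H (h i)

/-- The lattice points `h` with `|h i| < H` for all `i`; unlike `freqBox d H` it contains `0`. -/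
noncomputable def fullFreqBox (d H : ℕ) : Finset (Fin d → ℤ) :=
  Fintype.piFinset fun _ => Finset.Ioo (-(H : ℤ)) (H : ℤ)

lemma torusKernel_nonneg (H : ℕ) (y : UnitAddTorus (Fin d)) : 0 ≤ torusKernel d H y :=
  Finset.prod_nonneg fun _ _ => circleKernel_nonneg H _

lemma continuous_torusKernel (H : ℕ) : Continuous (torusKernel d H) := by
  unfold torusKernel
  exact continuous_finsetProd _ fun i _ => (continuous_circleKernel H).comp (continuous_apply i)

lemma torusKernel_eq_sum (H : ℕ) (y : UnitAddTorus (Fin d)) :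
    (torusKernel d H y : ℂ) =
      ∑ h ∈ fullFreqBox d H, (torusKernelCoeff H h : ℂ) * UnitAddTorus.mFourier h y := by
  simp only [torusKernel, torusKernelCoeff, Complex.ofReal_prod, circleKernel_eq_sum]
  rw [Finset.prod_univ_sum]
  refine Finset.sum_congr rfl fun h _ => ?_
  rw [Finset.prod_mul_distrib]
  rfl

lemma integral_mFourier_mul_torusKernel (H : ℕ) (h : Fin d → ℤ) :
    ∫ y, UnitAddTorus.mFourier (-h) y * (torusKernel d H y : ℂ) ∂torusHaar d =
      torusKernelCoeff H h := by
  have h1 : ∀ y : UnitAddTorus (Fin d),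
      UnitAddTorus.mFourier (-h) y * (torusKernel d H y : ℂ) =
      ∑ g ∈ fullFreqBox d H, (torusKernelCoeff H g : ℂ) * UnitAddTorus.mFourier (g - h) y := by
    intro y
    rw [torusKernel_eq_sum, Finset.mul_sum]
    refine Finset.sum_congr rfl fun g _ => ?_
    rw [sub_eq_add_neg, UnitAddTorus.mFourier_add]
    ring
  simp only [h1]
  rw [integral_finsetSum _ fun g _ =>
    integrable_of_continuous (by fun_prop) _]
  simp only [integral_const_mul, integral_mFourier, sub_eq_zero]
  rw [Finset.sum_eq_single h (fun g _ hg => by simp [hg])]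
  · simp
  · intro hh
    rw [fullFreqBox, Fintype.mem_piFinset, not_forall] at hh
    obtain ⟨i, hi⟩ := hh
    rw [torusKernelCoeff, Finset.prod_eq_zero (Finset.mem_univ i) (circleKernelCoeff_eq_zero hi)]
    simp

lemma integral_torusKernel {H : ℕ} (hH : 1 ≤ H) :
    ∫ y, torusKernel d H y ∂torusHaar d = 1 := by
  have h := integral_mFourier_mul_torusKernel (d := d) H 0
  simp only [neg_zero, UnitAddTorus.mFourier_zero, ContinuousMap.one_apply, one_mul,
    torusKernelCoeff, Pi.zero_apply, circleKernelCoeff_zero hH, Finset.prod_const_one] at h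
  rw [integral_complex_ofReal] at h
  exact_mod_cast h

lemma abs_torusKernelCoeff_le {H : ℕ} (hH : 1 ≤ H) (h : Fin d → ℤ) :
    |torusKernelCoeff H h| ≤ 1 := by
  have h1 : ‖∫ y, UnitAddTorus.mFourier (-h) y * (torusKernel d H y : ℂ) ∂torusHaar d‖ ≤
      ∫ y, torusKernel d H y ∂torusHaar d := by
    refine norm_integral_le_of_norm_le
      (integrable_of_continuous (continuous_torusKernel H) _) (ae_of_all _ fun y => ?_)
    rw [norm_mul, Complex.norm_real, Real.norm_of_nonneg (torusKernel_nonneg H y)]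
    refine mul_le_of_le_one_left (torusKernel_nonneg H y) ?_
    exact ((UnitAddTorus.mFourier (-h)).norm_coe_le_norm y).trans UnitAddTorus.mFourier_norm.le
  rwa [integral_mFourier_mul_torusKernel, integral_torusKernel hH, Complex.norm_real] at h1

lemma torusKernelCoeff_single {H : ℕ} (hH : 1 ≤ H) (i : Fin d) :
    torusKernelCoeff H (Pi.single i 1) = circleKernelCoeff H 1 := by
  rw [torusKernelCoeff, Finset.prod_eq_single i]
  · simp
  · intro j _ hj
    simp [hj, circleKernelCoeff_zero hH]
  · simp

lemma integral_norm_sq_mul_torusKernel_le {H : ℕ} (hH : 1 ≤ H) (i : Fin d) :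
    ∫ y, ‖y i‖ ^ 2 * torusKernel d H y ∂torusHaar d ≤ 1 / (H : ℝ) ^ 2 := by
  have hmF : ∀ y : UnitAddTorus (Fin d),
      UnitAddTorus.mFourier (-Pi.single i 1) y = fourier (-1) (y i) := by
    intro y
    rw [UnitAddTorus.mFourier_neg, UnitAddTorus.mFourier_single, fourier_neg]
  have hK := continuous_torusKernel (d := d) H
  have hF : Continuous fun y : UnitAddTorus (Fin d) =>
      UnitAddTorus.mFourier (-Pi.single i 1) y * (torusKernel d H y : ℂ) :=
    (ContinuousMap.continuous _).mul (Complex.continuous_ofReal.comp hK)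
  have hre : ∫ y, (UnitAddTorus.mFourier (-Pi.single i 1) y * (torusKernel d H y : ℂ)).re
      ∂torusHaar d = circleKernelCoeff H 1 := by
    have := integral_re (𝕜 := ℂ) (integrable_of_continuous hF (torusHaar d))
    simp only [RCLike.re_to_complex] at this
    rw [this, integral_mFourier_mul_torusKernel, torusKernelCoeff_single hH, Complex.ofReal_re]
  have hFre : Continuous fun y : UnitAddTorus (Fin d) =>
      (UnitAddTorus.mFourier (-Pi.single i 1) y * (torusKernel d H y : ℂ)).re :=
    Complex.continuous_re.comp hF
  have hle : ∫ y, ‖y i‖ ^ 2 * torusKernel d H y ∂torusHaar d ≤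
      ∫ y, (torusKernel d H y -
        (UnitAddTorus.mFourier (-Pi.single i 1) y * (torusKernel d H y : ℂ)).re) / 8
        ∂torusHaar d := by
    refine integral_mono (integrable_of_continuous (by fun_prop) _)
      (integrable_of_continuous
        ((hK.sub hFre).div_const _) _) fun y => ?_
    have h1 := mul_le_mul_of_nonneg_right (norm_sq_le_one_sub_re_fourier (y i))
      (torusKernel_nonneg H y)
    simp only [hmF, Complex.re_mul_ofReal]
    linarith
  rw [integral_div, integral_sub (integrable_of_continuous hK _)
    (integrable_of_continuous hFre _), hre,
    integral_torusKernel hH] at hle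
  have := one_sub_circleKernelCoeff_one_le hH
  have h8 : 8 / (H : ℝ) ^ 2 = 8 * (1 / (H : ℝ) ^ 2) := by ring
  linarith

lemma torusDist_eq (x y : UnitAddTorus (Fin d)) :
    torusDist x y = √(∑ i, ‖x i - y i‖ ^ 2) := by
  rw [torusDist, PiLp.dist_eq_of_L2]
  simp only [dist_eq_norm]

lemma torusDist_le_sum (x y : UnitAddTorus (Fin d)) : torusDist x y ≤ ∑ i, ‖x i - y i‖ := by
  rw [torusDist_eq]
  refine Real.sqrt_le_iff.2 ⟨Finset.sum_nonneg fun _ _ => norm_nonneg _, ?_⟩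
  exact Finset.sum_sq_le_sq_sum_of_nonneg fun _ _ => norm_nonneg _

/-- The convolution of `u` with `torusKernel d H`. -/
noncomputable def smoothed (H : ℕ) (u : UnitAddTorus (Fin d) → ℝ) (x : UnitAddTorus (Fin d)) : ℝ :=
  ∫ y, torusKernel d H y * u (x - y) ∂torusHaar d

/-- Smoothing moves a `t`-Lipschitz function by at most `t d / H`, because
`∑ i, ‖y i‖` has integral at most `d / H` against the kernel. -/
lemma abs_sub_smoothed_le {H : ℕ} (hH : 1 ≤ H) {u : UnitAddTorus (Fin d) → ℝ}
    (hu : Continuous u) {t : ℝ} (ht : 0 ≤ t) (hlip : ∀ x y, u x - u y ≤ t * torusDist x y)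
    (x : UnitAddTorus (Fin d)) : |u x - smoothed H u x| ≤ t * (d / H) := by
  have hH' : (0 : ℝ) < H := by exact_mod_cast hH
  have hK := continuous_torusKernel (d := d) H
  have habs : ∀ y, |u x - u (x - y)| ≤ t * ∑ i, ‖y i‖ := by
    intro y
    have h1 : torusDist x (x - y) ≤ ∑ i, ‖y i‖ := by
      simpa using torusDist_le_sum x (x - y)
    have h2 : torusDist (x - y) x ≤ ∑ i, ‖y i‖ := by
      simpa using torusDist_le_sum (x - y) x
    rw [abs_le]
    constructor
    · have := (hlip (x - y) x).trans (mul_le_mul_of_nonneg_left h2 ht)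
      linarith
    · exact (hlip x (x - y)).trans (mul_le_mul_of_nonneg_left h1 ht)
  have hdiff : u x - smoothed H u x =
      ∫ y, torusKernel d H y * (u x - u (x - y)) ∂torusHaar d := by
    simp only [mul_sub]
    rw [integral_sub (integrable_of_continuous (by fun_prop) _)
      (integrable_of_continuous (by fun_prop) _), integral_mul_const,
      integral_torusKernel hH, one_mul, smoothed]
  have hbound : ∀ y, |torusKernel d H y * (u x - u (x - y))| ≤
      t * ∑ i, (H / 2 * (‖y i‖ ^ 2 * torusKernel d H y) + 1 / (2 * H) * torusKernel d H y) := by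
    intro y
    rw [abs_mul, abs_of_nonneg (torusKernel_nonneg H y)]
    calc torusKernel d H y * |u x - u (x - y)|
        ≤ torusKernel d H y * (t * ∑ i, ‖y i‖) :=
          mul_le_mul_of_nonneg_left (habs y) (torusKernel_nonneg H y)
      _ = t * ∑ i, ‖y i‖ * torusKernel d H y := by rw [← Finset.sum_mul]; ring
      _ ≤ _ := by
          refine mul_le_mul_of_nonneg_left (Finset.sum_le_sum fun i _ => ?_) ht
          -- AM-GM at the scale `1 / H` of the kernel: it replaces the first moment by the second.
          have h3 : ‖y i‖ ≤ H / 2 * ‖y i‖ ^ 2 + 1 / (2 * H) := by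
            have : H / 2 * ‖y i‖ ^ 2 + 1 / (2 * H) - ‖y i‖ =
                (H * ‖y i‖ - 1) ^ 2 / (2 * H) := by
              field_simp
              ring
            have h4 : 0 ≤ (H * ‖y i‖ - 1) ^ 2 / (2 * H) := by positivity
            linarith
          calc ‖y i‖ * torusKernel d H y
              ≤ (H / 2 * ‖y i‖ ^ 2 + 1 / (2 * H)) * torusKernel d H y :=
                mul_le_mul_of_nonneg_right h3 (torusKernel_nonneg H y)
            _ = _ := by ring
  rw [hdiff, ← Real.norm_eq_abs]
  refine (norm_integral_le_of_norm_le (integrable_of_continuous (by fun_prop) _)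
    (ae_of_all _ hbound)).trans ?_
  rw [integral_const_mul, integral_finsetSum _ fun i _ =>
    integrable_of_continuous (by fun_prop) _]
  refine mul_le_mul_of_nonneg_left ?_ ht
  calc _ ≤ ∑ _i : Fin d, 1 / (H : ℝ) := by
        refine Finset.sum_le_sum fun i _ => ?_
        rw [integral_add (integrable_of_continuous (by fun_prop) _)
          (integrable_of_continuous (by fun_prop) _), integral_const_mul,
          integral_const_mul, integral_torusKernel hH]
        have h5 := mul_le_mul_of_nonneg_left (integral_norm_sq_mul_torusKernel_le hH i)
          (by positivity : (0 : ℝ) ≤ H / 2)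
        have h6 : (H : ℝ) / 2 * (1 / (H : ℝ) ^ 2) + 1 / (2 * H) * 1 = 1 / H := by
          field_simp
          ring
        linarith
    _ = d / H := by simp [div_eq_mul_inv]

/-- The Fourier coefficient of a real function on the torus. -/
noncomputable def realCoeff (u : UnitAddTorus (Fin d) → ℝ) (h : Fin d → ℤ) : ℂ :=
  ∫ x, UnitAddTorus.mFourier (-h) x * (u x : ℂ) ∂torusHaar d

lemma mFourier_add_apply (h : Fin d → ℤ) (x y : UnitAddTorus (Fin d)) :
    UnitAddTorus.mFourier h (x + y) =
      UnitAddTorus.mFourier h x * UnitAddTorus.mFourier h y := by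
  simp only [UnitAddTorus.mFourier, ContinuousMap.coe_mk, ← Finset.prod_mul_distrib]
  refine Finset.prod_congr rfl fun i _ => ?_
  rw [Pi.add_apply, fourier_apply, smul_add, AddCircle.toCircle_add, Circle.coe_mul,
    fourier_apply, fourier_apply]

lemma mFourier_neg_apply (h : Fin d → ℤ) (x : UnitAddTorus (Fin d)) :
    UnitAddTorus.mFourier h (-x) = UnitAddTorus.mFourier (-h) x := by
  simp only [UnitAddTorus.mFourier, ContinuousMap.coe_mk]
  refine Finset.prod_congr rfl fun i _ => ?_
  rw [Pi.neg_apply, Pi.neg_apply, fourier_apply, fourier_apply, smul_neg, neg_smul]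

lemma smoothed_eq_sum (H : ℕ) {u : UnitAddTorus (Fin d) → ℝ} (hu : Continuous u)
    (x : UnitAddTorus (Fin d)) :
    (smoothed H u x : ℂ) =
      ∑ h ∈ fullFreqBox d H,
        (torusKernelCoeff H h : ℂ) * realCoeff u h * UnitAddTorus.mFourier h x := by
  have h1 : (smoothed H u x : ℂ) =
      ∫ y, (torusKernel d H (x - y) : ℂ) * (u y : ℂ) ∂torusHaar d := by
    rw [smoothed, ← integral_sub_left_eq_self _ _ x, ← integral_complex_ofReal]
    simp
  rw [h1]
  simp only [torusKernel_eq_sum, Finset.sum_mul]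
  rw [integral_finsetSum _ fun g _ => integrable_of_continuous (by fun_prop) _]
  refine Finset.sum_congr rfl fun h _ => ?_
  rw [realCoeff, mul_assoc, ← integral_mul_const, ← integral_const_mul]
  refine integral_congr_ae (ae_of_all _ fun y => ?_)
  simp only [sub_eq_add_neg, mFourier_add_apply, mFourier_neg_apply]
  ring

end Smoothing

/-! ### The Dirichlet energy of a Lipschitz function -/

section Gradient

variable {d : ℕ}

lemma mFourier_single_coe (h : Fin d → ℤ) (i : Fin d) (s : ℝ) :
    UnitAddTorus.mFourier h (Pi.single i (s : UnitAddCircle)) =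
      Complex.exp (s * (2 * Real.pi * Complex.I * h i)) := by
  simp only [UnitAddTorus.mFourier, ContinuousMap.coe_mk]
  rw [Finset.prod_eq_single i]
  · rw [Pi.single_eq_same, fourier_coe_apply]
    congr 1
    push_cast
    ring
  · intro j _ hj
    rw [Pi.single_eq_of_ne hj, fourier_eval_zero]
  · simp

lemma realCoeff_translate_sub {u : UnitAddTorus (Fin d) → ℝ} (hu : Continuous u)
    (a : UnitAddTorus (Fin d)) (h : Fin d → ℤ) :
    ∫ x, UnitAddTorus.mFourier (-h) x * ((u (x + a) : ℂ) - u x) ∂torusHaar d =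
      (UnitAddTorus.mFourier h a - 1) * realCoeff u h := by
  simp only [mul_sub]
  rw [integral_sub (integrable_of_continuous (by fun_prop) _)
    (integrable_of_continuous (by fun_prop) _), sub_mul, one_mul]
  congr 1
  rw [realCoeff,
    ← integral_add_right_eq_self (fun x => UnitAddTorus.mFourier (-h) x * (u x : ℂ)) a,
    ← integral_const_mul]
  refine integral_congr_ae (ae_of_all _ fun x => ?_)
  have h1 : UnitAddTorus.mFourier h a * UnitAddTorus.mFourier (-h) a = 1 := by
    rw [← UnitAddTorus.mFourier_add, add_neg_cancel, UnitAddTorus.mFourier_zero,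
      ContinuousMap.one_apply]
  simp only [mFourier_add_apply]
  linear_combination (-(UnitAddTorus.mFourier (-h) x) * u (x + a)) * h1

lemma torusDist_add_single_le (x : UnitAddTorus (Fin d)) (i : Fin d) (s : ℝ) :
    torusDist (x + Pi.single i (s : UnitAddCircle)) x ≤ |s| := by
  refine (torusDist_le_sum _ _).trans ?_
  simp only [Pi.add_apply, add_sub_cancel_left]
  rw [Finset.sum_eq_single i]
  · rw [Pi.single_eq_same]
    simpa [UnitAddCircle.norm_eq] using round_le s 0
  · intro j _ hj
    rw [Pi.single_eq_of_ne hj, norm_zero]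
  · simp

lemma torusDist_comm (x y : UnitAddTorus (Fin d)) : torusDist x y = torusDist y x := dist_comm _ _

/-- Bessel's inequality for the difference of `u` and its translate by `s` in the direction `i`. -/
lemma sum_norm_sq_mul_realCoeff_le {u : UnitAddTorus (Fin d) → ℝ} (hu : Continuous u) {t : ℝ}
    (ht : 0 ≤ t) (hlip : ∀ x y, u x - u y ≤ t * torusDist x y) (S : Finset (Fin d → ℤ))
    (i : Fin d) (s : ℝ) :
    ∑ h ∈ S, ‖(Complex.exp (s * (2 * Real.pi * Complex.I * h i)) - 1) * realCoeff u h‖ ^ 2 ≤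
      (t * s) ^ 2 := by
  set a : UnitAddTorus (Fin d) := Pi.single i (s : UnitAddCircle) with ha
  let v : C(UnitAddTorus (Fin d), ℂ) := ⟨fun x => (u (x + a) : ℂ) - u x, by fun_prop⟩
  have hB := sum_norm_sq_integral_mFourier_le v S
  have hv : ∀ x, ‖v x‖ ^ 2 ≤ (t * s) ^ 2 := by
    intro x
    have hvx : v x = ((u (x + a) - u x : ℝ) : ℂ) := by simp [v]
    rw [hvx, Complex.norm_real, Real.norm_eq_abs, ← sq_abs (t * s), abs_mul, abs_of_nonneg ht]
    refine pow_le_pow_left₀ (abs_nonneg _) (abs_le.2 ?_) 2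
    have h1 := mul_le_mul_of_nonneg_left (torusDist_add_single_le x i s) ht
    have h2 := hlip (x + a) x
    have h3 := hlip x (x + a)
    rw [torusDist_comm] at h3
    constructor <;> linarith
  have hI : ∫ x, ‖v x‖ ^ 2 ∂torusHaar d ≤ ∫ _, (t * s) ^ 2 ∂torusHaar d :=
    integral_mono (integrable_of_continuous (by fun_prop) _) (integrable_const _) hv
  simp only [integral_const, probReal_univ, one_smul] at hI
  refine le_trans (le_of_eq (Finset.sum_congr rfl fun h _ => ?_)) (hB.trans hI)
  rw [← mFourier_single_coe, ← realCoeff_translate_sub hu]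
  rfl

/-- The bound `∫ |∂ᵢ u|² ≤ t²` on the Fourier side. It is the limit `s → 0` of the inequality for
difference quotients, so no differentiability of `u` is needed. -/
lemma sum_sq_mul_norm_sq_realCoeff_le {u : UnitAddTorus (Fin d) → ℝ} (hu : Continuous u) {t : ℝ}
    (ht : 0 ≤ t) (hlip : ∀ x y, u x - u y ≤ t * torusDist x y) (S : Finset (Fin d → ℤ))
    (i : Fin d) :
    ∑ h ∈ S, (2 * Real.pi * |(h i : ℝ)| * ‖realCoeff u h‖) ^ 2 ≤ t ^ 2 := by
  have hlim : ∀ h : Fin d → ℤ, Filter.Tendsto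
      (fun s : ℝ => ‖s⁻¹ • ((Complex.exp (s * (2 * Real.pi * Complex.I * h i)) - 1) *
        realCoeff u h)‖ ^ 2) (nhdsWithin 0 {0}ᶜ)
      (nhds ((2 * Real.pi * |(h i : ℝ)| * ‖realCoeff u h‖) ^ 2)) := by
    intro h
    have hd : HasDerivAt (fun s : ℝ => Complex.exp (s * (2 * Real.pi * Complex.I * h i)) *
        realCoeff u h) (2 * Real.pi * Complex.I * h i * realCoeff u h) 0 := by
      have h1 : HasDerivAt (fun s : ℝ => (s : ℂ) * (2 * Real.pi * Complex.I * h i))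
          (2 * Real.pi * Complex.I * h i) 0 := by
        simpa using (Complex.ofRealCLM.hasDerivAt (x := (0 : ℝ))).mul_const
          (2 * Real.pi * Complex.I * h i)
      simpa using h1.cexp.mul_const (realCoeff u h)
    have h2 := (hd.tendsto_slope_zero.norm).pow 2
    have h3 : ‖2 * (Real.pi : ℂ) * Complex.I * (h i : ℂ) * realCoeff u h‖ =
        2 * Real.pi * |(h i : ℝ)| * ‖realCoeff u h‖ := by
      simp [abs_of_pos Real.pi_pos]
    rw [h3] at h2
    simpa [sub_mul] using h2
  refine le_of_tendsto (tendsto_finsetSum S fun h _ => hlim h) ?_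
  filter_upwards [self_mem_nhdsWithin] with s hs
  have hs' : 0 < s ^ 2 := by
    have : s ≠ 0 := hs
    positivity
  have h1 := sum_norm_sq_mul_realCoeff_le hu ht hlip S i s
  simp only [norm_smul, norm_inv, mul_pow, inv_pow, Real.norm_eq_abs, sq_abs]
  rw [← Finset.mul_sum, inv_mul_le_iff₀ hs']
  simp only [← mul_pow]
  linarith [mul_pow t s 2, mul_comm (t ^ 2) (s ^ 2)]

lemma sum_normSq_mul_norm_sq_realCoeff_le {u : UnitAddTorus (Fin d) → ℝ} (hu : Continuous u) {t : ℝ}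
    (ht : 0 ≤ t) (hlip : ∀ x y, u x - u y ≤ t * torusDist x y) (S : Finset (Fin d → ℤ)) :
    ∑ h ∈ S, (∑ i, (h i : ℝ) ^ 2) * ‖realCoeff u h‖ ^ 2 ≤ d * t ^ 2 / (2 * Real.pi) ^ 2 := by
  have hpi : 0 < (2 * Real.pi) ^ 2 := by positivity
  rw [le_div_iff₀ hpi]
  calc (∑ h ∈ S, (∑ i, (h i : ℝ) ^ 2) * ‖realCoeff u h‖ ^ 2) * (2 * Real.pi) ^ 2
      = ∑ i : Fin d, ∑ h ∈ S, (2 * Real.pi * |(h i : ℝ)| * ‖realCoeff u h‖) ^ 2 := by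
        rw [Finset.sum_comm, Finset.sum_mul]
        refine Finset.sum_congr rfl fun h _ => ?_
        rw [Finset.sum_mul, Finset.sum_mul]
        refine Finset.sum_congr rfl fun i _ => ?_
        rw [mul_pow (2 * Real.pi * |(h i : ℝ)|), mul_pow (2 * Real.pi), sq_abs]
        ring
    _ ≤ ∑ _i : Fin d, t ^ 2 :=
        Finset.sum_le_sum fun i _ => sum_sq_mul_norm_sq_realCoeff_le hu ht hlip S i
    _ = d * t ^ 2 := by simp

end Gradient

/-! ### Testing the difference of two measures against a Lipschitz function -/

section Main

variable {d : ℕ}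

lemma integral_mFourier_eq_conj (ν : Measure (UnitAddTorus (Fin d))) (h : Fin d → ℤ) :
    ∫ x, UnitAddTorus.mFourier h x ∂ν = (starRingEnd ℂ) (fourierCoeffMeasure ν h) := by
  rw [fourierCoeffMeasure, ← integral_conj]
  simp only [UnitAddTorus.mFourier_neg, Complex.conj_conj]

lemma integral_smoothed (H : ℕ) {u : UnitAddTorus (Fin d) → ℝ} (hu : Continuous u)
    (ν : Measure (UnitAddTorus (Fin d))) [IsProbabilityMeasure ν] :
    ((∫ x, smoothed H u x ∂ν : ℝ) : ℂ) = ∑ h ∈ fullFreqBox d H,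
      (torusKernelCoeff H h : ℂ) * realCoeff u h * (starRingEnd ℂ) (fourierCoeffMeasure ν h) := by
  rw [← integral_complex_ofReal]
  simp only [smoothed_eq_sum H hu]
  rw [integral_finsetSum _ fun g _ => integrable_of_continuous (by fun_prop) _]
  simp only [integral_const_mul, integral_mFourier_eq_conj]

lemma continuous_smoothed (H : ℕ) {u : UnitAddTorus (Fin d) → ℝ} (hu : Continuous u) :
    Continuous (smoothed H u) := by
  have h1 : smoothed H u = fun x => (∑ h ∈ fullFreqBox d H,
      (torusKernelCoeff H h : ℂ) * realCoeff u h * UnitAddTorus.mFourier h x).re := by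
    funext x
    rw [← smoothed_eq_sum H hu, Complex.ofReal_re]
  rw [h1]
  fun_prop

lemma freqBox_eq_erase (d H : ℕ) : freqBox d H = (fullFreqBox d H).erase 0 := rfl

/-- The Cauchy–Schwarz inequality between the Dirichlet energy of `u` and the weighted sum of the
squared differences of Fourier coefficients. -/
lemma abs_integral_smoothed_sub_le {H : ℕ} (hH : 1 ≤ H) {u : UnitAddTorus (Fin d) → ℝ}
    (hu : Continuous u) {t : ℝ} (ht : 0 ≤ t) (hlip : ∀ x y, u x - u y ≤ t * torusDist x y)
    (ν₁ ν₂ : Measure (UnitAddTorus (Fin d))) [IsProbabilityMeasure ν₁] [IsProbabilityMeasure ν₂] :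
    |∫ x, smoothed H u x ∂ν₁ - ∫ x, smoothed H u x ∂ν₂| ≤
      t * (√(d : ℝ) / (2 * Real.pi) *
        √(∑ h ∈ freqBox d H,
          ‖fourierCoeffMeasure ν₁ h - fourierCoeffMeasure ν₂ h‖ ^ 2 / ∑ i, (h i : ℝ) ^ 2)) := by
  set Δ : (Fin d → ℤ) → ℂ := fun h => fourierCoeffMeasure ν₁ h - fourierCoeffMeasure ν₂ h with hΔ
  have hΔ0 : Δ 0 = 0 := by
    simp [hΔ, fourierCoeffMeasure, UnitAddTorus.mFourier_zero]
  have hsum : ((∫ x, smoothed H u x ∂ν₁ - ∫ x, smoothed H u x ∂ν₂ : ℝ) : ℂ) =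
      ∑ h ∈ freqBox d H, (torusKernelCoeff H h : ℂ) * realCoeff u h * (starRingEnd ℂ) (Δ h) := by
    rw [freqBox_eq_erase, Finset.sum_erase _ (by rw [hΔ0, map_zero, mul_zero]), Complex.ofReal_sub,
      integral_smoothed H hu, integral_smoothed H hu, ← Finset.sum_sub_distrib]
    simp only [hΔ, map_sub, mul_sub]
  have hN : ∀ h ∈ freqBox d H, 0 < ∑ i, (h i : ℝ) ^ 2 := by
    intro h hh
    have hne : h ≠ 0 := by
      rw [freqBox_eq_erase] at hh
      exact (Finset.mem_erase.1 hh).1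
    obtain ⟨i, hi⟩ := Function.ne_iff.1 hne
    have hi' : (h i : ℝ) ≠ 0 := by exact_mod_cast hi
    exact (by positivity : 0 < (h i : ℝ) ^ 2).trans_le
      (Finset.single_le_sum (f := fun i => (h i : ℝ) ^ 2) (fun _ _ => sq_nonneg _)
        (Finset.mem_univ i))
  have hterm : |∫ x, smoothed H u x ∂ν₁ - ∫ x, smoothed H u x ∂ν₂| ≤
      ∑ h ∈ freqBox d H, (√(∑ i, (h i : ℝ) ^ 2) * ‖realCoeff u h‖) *
        (‖Δ h‖ / √(∑ i, (h i : ℝ) ^ 2)) := by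
    rw [← Real.norm_eq_abs, ← Complex.norm_real, hsum]
    refine (norm_sum_le _ _).trans (Finset.sum_le_sum fun h hh => ?_)
    have hpos := Real.sqrt_pos.2 (hN h hh)
    rw [norm_mul, norm_mul, RCLike.norm_conj, Complex.norm_real, Real.norm_eq_abs]
    calc |torusKernelCoeff H h| * ‖realCoeff u h‖ * ‖Δ h‖ ≤ 1 * ‖realCoeff u h‖ * ‖Δ h‖ := by
          gcongr
          exact abs_torusKernelCoeff_le hH h
      _ = _ := by field_simp
  refine hterm.trans ((Real.sum_mul_le_sqrt_mul_sqrt _ _ _).trans ?_)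
  rw [← mul_assoc]
  refine mul_le_mul ?_ (le_of_eq ?_) (Real.sqrt_nonneg _) (by positivity)
  · refine Real.sqrt_le_iff.2 ⟨by positivity, ?_⟩
    have hG := sum_normSq_mul_norm_sq_realCoeff_le hu ht hlip (freqBox d H)
    have he : (t * (√(d : ℝ) / (2 * Real.pi))) ^ 2 = d * t ^ 2 / (2 * Real.pi) ^ 2 := by
      rw [mul_pow, div_pow, Real.sq_sqrt (Nat.cast_nonneg d)]
      ring
    rw [he]
    refine le_trans (le_of_eq (Finset.sum_congr rfl fun h hh => ?_)) hG
    rw [mul_pow, Real.sq_sqrt (hN h hh).le]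
  · congr 1
    refine Finset.sum_congr rfl fun h hh => ?_
    rw [div_pow, Real.sq_sqrt (hN h hh).le]

lemma integral_sub_integral_le {H : ℕ} (hH : 1 ≤ H) {u : UnitAddTorus (Fin d) → ℝ}
    (hu : Continuous u) {t : ℝ} (ht : 0 ≤ t) (hlip : ∀ x y, u x - u y ≤ t * torusDist x y)
    (ν₁ ν₂ : Measure (UnitAddTorus (Fin d))) [IsProbabilityMeasure ν₁] [IsProbabilityMeasure ν₂] :
    ∫ x, u x ∂ν₁ - ∫ x, u x ∂ν₂ ≤
      t * (2 * d / H + √(d : ℝ) / (2 * Real.pi) *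
        √(∑ h ∈ freqBox d H,
          ‖fourierCoeffMeasure ν₁ h - fourierCoeffMeasure ν₂ h‖ ^ 2 / ∑ i, (h i : ℝ) ^ 2)) := by
  have hclose : ∀ (ν : Measure (UnitAddTorus (Fin d))) [IsProbabilityMeasure ν],
      |∫ x, u x ∂ν - ∫ x, smoothed H u x ∂ν| ≤ t * (d / H) := by
    intro ν _
    rw [← integral_sub (integrable_of_continuous hu _)
      (integrable_of_continuous (continuous_smoothed H hu) _), ← Real.norm_eq_abs]
    refine (norm_integral_le_of_norm_le_const
      (ae_of_all _ fun x => abs_sub_smoothed_le hH hu ht hlip x)).trans ?_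
    simp
  have h1 := (abs_le.1 (hclose ν₁)).2
  have h2 := (abs_le.1 (hclose ν₂)).1
  have h3 := (abs_le.1 (abs_integral_smoothed_sub_le hH hu ht hlip ν₁ ν₂)).2
  rw [mul_add]
  have h4 : t * (2 * d / H) = t * (d / H) + t * (d / H) := by ring
  linarith

lemma wassersteinOne_le_integral {ν₁ ν₂ : Measure (UnitAddTorus (Fin d))}
    {ϑ : Measure (UnitAddTorus (Fin d) × UnitAddTorus (Fin d))} (hϑ : IsCoupling ϑ ν₁ ν₂) :
    wassersteinOne ν₁ ν₂ ≤ ∫ z, torusDist z.1 z.2 ∂ϑ := by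
  refine csInf_le ⟨0, ?_⟩ ⟨ϑ, hϑ, rfl⟩
  rintro _ ⟨ϑ', -, rfl⟩
  exact integral_nonneg fun _ => dist_nonneg

lemma continuous_torusDist :
    Continuous fun z : UnitAddTorus (Fin d) × UnitAddTorus (Fin d) => torusDist z.1 z.2 := by
  simp only [torusDist_eq]
  fun_prop

end Main

end TorusWasserstein

theorem proposition2 (d : ℕ) (ν₁ ν₂ : Measure (UnitAddTorus (Fin d)))
    [IsProbabilityMeasure ν₁] [IsProbabilityMeasure ν₂] (H : ℕ) (hH : 1 ≤ H) :
    TorusWasserstein.wassersteinOne ν₁ ν₂ ≤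
      6 * (d : ℝ) / (H : ℝ) +
        √(d : ℝ) / (2 * Real.pi) *
          √(∑ h ∈ TorusWasserstein.freqBox d H,
            ‖TorusWasserstein.fourierCoeffMeasure ν₁ h -
              TorusWasserstein.fourierCoeffMeasure ν₂ h‖ ^ 2 / ∑ i, (h i : ℝ) ^ 2) := by
  obtain ⟨ϑ, hprob, hfst, hsnd, hle⟩ := TorusWasserstein.exists_coupling_integral_le ν₁ ν₂
    (c := TorusWasserstein.torusDist) TorusWasserstein.continuous_torusDist
    (fun _ => dist_self _) (fun _ _ => dist_comm _ _) (fun _ _ _ => dist_triangle _ _ _)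
    (fun t u ht hlip => TorusWasserstein.integral_sub_integral_le hH u.continuous ht hlip ν₁ ν₂)
  refine (TorusWasserstein.wassersteinOne_le_integral ⟨hprob, hfst, hsnd⟩).trans (hle.trans ?_)
  gcongr
  norm_num
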